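/- Let $\mathbb X$ be a complex Banach space, $T$ a bounded linear operator on $\mathbb X$, $0<\alpha\le 1$, and $\nu\ge 0$ an integer. Put $k^\alpha(j)=\dfrac{\Gamma(\alpha+j)}{\Gamma(\alpha)\Gamma(j+1)}$ for $j\ge 0$, and let $S_\alpha=(S_\alpha(n))_{n\ge 0}$ be the $\alpha$-resolvent sequence of the fractional difference equation $\Delta^\alpha x(n)=Tx(n)+y(n)$, that is, the sequence of bounded operators on $\mathbb X$ determined by $$S_\alpha(0)=I,\qquad S_\alpha(n+1)=k^\alpha(n+1)I+T\sum_{j=0}^{n}k^\alpha(n-j)S_\alpha(j)\quad(n\ge 0).$$ Let $\Sigma$ be the set of those points $z_0$ of the unit circle $\{z\in\mathbb C:|z|=1\}$ for which it is not true that, in some neighbourhood of $z_0$, the inverse $\bigl(z^{1-\alpha}(z-1)^{\alpha}-T\bigr)^{-1}$ exists as a bounded operator and is a holomorphic function of $z$ (principal powers). Assume that $\Sigma\subset\{1\}$ and that $$\sup_{n\ge 1}\frac{\|S_\alpha(n)\|}{n^\nu}<\infty .$$ Then, with the translation operator $(Sx)(n)=x(n+1)$ on sequences, $$\lim_{n\to\infty}\frac1{n^\nu}\bigl((S-I)^{\nu+1}S_\alpha\bigr)(n)=0$$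 in operator norm; that is, $$\lim_{n\to\infty}\frac1{n^\nu}\sum_{k=0}^{\nu+1}\binom{\nu+1}{k}(-1)^{\nu+1+k}S_\alpha(n+k)=0 .$$ -/

import Mathlib

open Filter Topology

namespace FracKT

/-- The Cesàro-type kernel `k^α(j) = Γ(α + j) / (Γ(α) Γ(j + 1))`. -/
noncomputable def kernel (α : ℝ) (j : ℕ) : ℝ :=
  Real.Gamma (α + j) / (Real.Gamma α * Real.Gamma ((j : ℝ) + 1))

section

variable {X : Type*} [NormedAddCommGroup X] [NormedSpace ℂ X]

/-- `S` is an `α`-resolvent sequence generated by `T`: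
`S(0) = I` and `S(n+1) = k^α(n+1) I + T ∑_{j=0}^n k^α(n-j) S(j)` for all `n ≥ 0`. -/
def IsAlphaResolvent (α : ℝ) (T : X →L[ℂ] X) (S : ℕ → X →L[ℂ] X) : Prop :=
  S 0 = 1 ∧ ∀ n : ℕ, S (n + 1) = (kernel α (n + 1) : ℂ) • (1 : X →L[ℂ] X) +
    T * ∑ j ∈ Finset.range (n + 1), (kernel α (n - j) : ℂ) • S j

/-- The `α`-resolvent sequence `S_α` of the equation `Δ^α x(n) = T x(n) + y(n)`. -/
noncomputable def alphaResolvent (α : ℝ) (T : X →L[ℂ] X) : ℕ → X →L[ℂ] X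
  | 0 => 1
  | n + 1 => (kernel α (n + 1) : ℂ) • (1 : X →L[ℂ] X) +
      T * ∑ j : Fin (n + 1), (kernel α (n - j) : ℂ) • alphaResolvent α T j
decreasing_by exact j.2

/-- `alphaResolvent α T` is the one and only `α`-resolvent sequence generated by `T`. -/
theorem isAlphaResolvent_iff (α : ℝ) (T : X →L[ℂ] X) (S : ℕ → X →L[ℂ] X) :
    IsAlphaResolvent α T S ↔ S = alphaResolvent α T := by
  constructor
  · rintro ⟨h0, hs⟩
    funext n
    induction n using Nat.strong_induction_on with
    | _ n ih =>
      cases n with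
      | zero => rw [h0, alphaResolvent]
      | succ n =>
        rw [hs, alphaResolvent, Finset.sum_range]
        congr 2
        refine Finset.sum_congr rfl fun j _ => ?_
        rw [ih j j.2]
  · rintro rfl
    refine ⟨by rw [alphaResolvent], fun n => ?_⟩
    rw [alphaResolvent, Finset.sum_range]

/-- The operator `z^{1-α} (z-1)^α I - T`, with principal powers. The product
`z^{1-α} (z-1)^α` of principal powers equals `z (1 - 1/z)^α` (principal power) for every `z`
outside the segment `[0,1]`; in particular it is holomorphic near every point of the unit circle
other than `1`. -/
noncomputable def charOp (α : ℝ) (T : X →L[ℂ] X) (z : ℂ) : X →L[ℂ] X :=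
  (z ^ ((1 - α : ℝ) : ℂ) * (z - 1) ^ (α : ℂ)) • (1 : X →L[ℂ] X) - T

/-- The set `Σ₀` of the points `z₀` of the unit circle such that `(z^{1-α} (z-1)^α - T)⁻¹` exists
and is holomorphic in a neighbourhood of `z₀`. -/
def regularSet (α : ℝ) (T : X →L[ℂ] X) : Set ℂ :=
  {z₀ | z₀ ∈ Metric.sphere (0 : ℂ) 1 ∧ ∃ U : Set ℂ, IsOpen U ∧ z₀ ∈ U ∧
    (∀ z ∈ U, IsUnit (charOp α T z)) ∧
    DifferentiableOn ℂ (fun z => Ring.inverse (charOp α T z)) U}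

/-- The set `Σ` of bad points: the unit circle minus `Σ₀`. -/
def singularSet (α : ℝ) (T : X →L[ℂ] X) : Set ℂ :=
  Metric.sphere (0 : ℂ) 1 \ regularSet α T

/-- The translation operator `(S x)(n) = x(n+1)` on sequences of bounded operators. -/
def shift (X : Type*) [NormedAddCommGroup X] [NormedSpace ℂ X] :
    (ℕ → X →L[ℂ] X) →ₗ[ℂ] (ℕ → X →L[ℂ] X) :=
  LinearMap.funLeft ℂ (X →L[ℂ] X) (fun n : ℕ => n + 1)

end

end FracKT

/-! ### The binomial series of the kernel, and principal powers on the unit circle. -/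

namespace FracKT

/-! The proof is a Katznelson–Tzafriri argument on the generating function `F(w) = ∑ wⁿ S_α(n)`. The
recurrence and the binomial series of `(1 - w)^(-α)` give `((1 - w)^α - wT) F(w) = I` for `|w| < 1`
(`genInv_mul_tsum`). On the circle away from `1` this factor is `w` times the characteristic
operator at `1/w`, so `Σ ⊆ {1}` makes `F` extend continuously to the closed disc without `1`
(`continuousOn_inverse_genInv`).

The rest is Tauberian (`isLittleO_sub_of_continuousOn`). Let `a` be the samples `δψ(δk)`, where `ψ`
is the Fourier transform of a bump `φ`. The coefficients of `x - a * x` are integrals of the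
boundary values of `F` against `1 - φ(θ/δ)`, which vanishes near the bad point, so they tend to `0`
by Riemann–Lebesgue. The difference of `a * x` is `(Δa) * x`, of asymptotic size at most `C‖Δa‖₁
n^ν`, and `‖Δa‖₁ ≤ δ‖ψ'‖₁` is as small as desired.

Thus one difference is already `o(n^ν)`; the other `ν` differences preserve this. -/

theorem kernel_zero {α : ℝ} (hα : 0 < α) : kernel α 0 = 1 := by
  have := (Real.Gamma_pos_of_pos hα).ne'
  simp [kernel, this]

theorem kernel_succ {α : ℝ} (hα : 0 < α) (n : ℕ) :
    ((n : ℝ) + 1) * kernel α (n + 1) = (α + n) * kernel α n := by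
  have h1 := (Real.Gamma_pos_of_pos hα).ne'
  have h2 : Real.Gamma ((n : ℝ) + 1) ≠ 0 := (Real.Gamma_pos_of_pos (by positivity)).ne'
  have h3 : (n : ℝ) + 1 ≠ 0 := by positivity
  have h4 : α + n ≠ 0 := by positivity
  simp only [kernel, Nat.cast_add, Nat.cast_one]
  rw [← add_assoc, Real.Gamma_add_one h4, Real.Gamma_add_one h3]
  field_simp

/-- Both sides obey the same first-order recurrence; this identifies the kernel with the
coefficients of the binomial series. -/
theorem kernel_eq_multichoose {α : ℝ} (hα : 0 < α) (n : ℕ) :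
    (kernel α n : ℂ) = Ring.multichoose (α : ℂ) n := by
  induction n with
  | zero => simp [kernel_zero hα]
  | succ n ih =>
    have h1 : ((n : ℂ) + 1) * kernel α (n + 1) = (α + n) * kernel α n := by
      exact_mod_cast kernel_succ hα n
    have h2 := Ring.factorial_nsmul_multichoose_eq_ascPochhammer (α : ℂ) (n + 1)
    have h3 := Ring.factorial_nsmul_multichoose_eq_ascPochhammer (α : ℂ) n
    rw [ascPochhammer_succ_right, Polynomial.smeval_mul, ← h3, Nat.factorial_succ] at h2
    simp only [nsmul_eq_mul, Polynomial.smeval_add, Polynomial.smeval_X, pow_one,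
      Polynomial.smeval_natCast, pow_zero, mul_one, Nat.cast_mul, Nat.cast_add, Nat.cast_one] at h2
    have h4 : (n.factorial : ℂ) ≠ 0 := by exact_mod_cast n.factorial_ne_zero
    have h5 : (n : ℂ) + 1 ≠ 0 := by exact_mod_cast n.succ_ne_zero
    apply mul_left_cancel₀ h5
    apply mul_left_cancel₀ h4
    rw [h1, ih]
    linear_combination -h2

theorem summable_norm_kernel_mul_pow {α : ℝ} (hα : 0 < α) {w : ℂ} (hw : ‖w‖ < 1) :
    Summable fun n => ‖(kernel α n : ℂ) * w ^ n‖ := by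
  have h := Complex.one_div_one_sub_cpow_hasFPowerSeriesOnBall_zero (α : ℂ)
  have h1 : w ∈ Metric.eball (0 : ℂ)
      (FormalMultilinearSeries.ofScalars ℂ fun n ↦ Ring.choose ((α : ℂ) + n - 1) n).radius := by
    refine Metric.eball_subset_eball h.r_le ?_
    rw [← ENNReal.ofReal_one, Metric.eball_ofReal]
    simpa using hw
  refine (FormalMultilinearSeries.summable_norm_apply _ h1).congr fun n => ?_
  simp [kernel_eq_multichoose hα, Ring.multichoose_eq, mul_comm]

theorem hasSum_kernel_mul_pow {α : ℝ} (hα : 0 < α) {w : ℂ} (hw : ‖w‖ < 1) :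
    HasSum (fun n => (kernel α n : ℂ) * w ^ n) ((1 - w) ^ (α : ℂ))⁻¹ := by
  have h := Complex.one_div_one_sub_cpow_hasFPowerSeriesOnBall_zero (α : ℂ)
  have h1 : w ∈ Metric.eball (0 : ℂ) 1 := by
    rw [← ENNReal.ofReal_one, Metric.eball_ofReal]
    simpa using hw
  have h2 := h.hasSum h1
  simp only [zero_add, one_div] at h2
  refine h2.congr_fun ?_
  intro n
  simp [kernel_eq_multichoose hα, Ring.multichoose_eq, mul_comm]

/-- This is the condition for `log` to be additive on `z * (1 - z⁻¹) = z - 1`. On the circle `1 -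
z⁻¹` has positive real part and the same imaginary part as `z`, so the three arguments lie on the
same side of `0`, and the possible discrepancy `2πk` must vanish. -/
theorem arg_add_arg_mem_Ioc {z : ℂ} (hz : ‖z‖ = 1) (h1 : z ≠ 1) :
    z.arg + (1 - z⁻¹).arg ∈ Set.Ioc (-Real.pi) Real.pi := by
  have hpi := Real.pi_pos
  have hz0 : z ≠ 0 := by rintro rfl; simp at hz
  have hinv : z⁻¹ = (starRingEnd ℂ) z := by
    rw [Complex.inv_def, Complex.normSq_eq_norm_sq, hz]; simp
  have hsq : z.re ^ 2 + z.im ^ 2 = 1 := by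
    have := Complex.sq_norm z
    rw [hz, Complex.normSq_apply] at this; linarith
  have hre : z.re < 1 := by
    rcases lt_or_ge z.re 1 with h | h
    · exact h
    · exfalso; apply h1
      apply Complex.ext <;> simp <;> nlinarith [sq_nonneg z.im]
  have hq1 : (1 - z⁻¹).re = 1 - z.re := by rw [hinv]; simp
  have hq2 : (1 - z⁻¹).im = z.im := by rw [hinv]; simp
  have hq0 : 1 - z⁻¹ ≠ 0 := fun h => by rw [h] at hq1; simp at hq1; linarith
  have habs : |(1 - z⁻¹).arg| < Real.pi / 2 := by
    rw [Complex.abs_arg_lt_pi_div_two_iff]; left; linarith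
  rw [abs_lt] at habs
  have hprod : z * (1 - z⁻¹) = z - 1 := by field_simp
  have hang := Complex.arg_mul_coe_angle hz0 hq0
  rw [hprod, ← Real.Angle.coe_add, Real.Angle.angle_eq_iff_two_pi_dvd_sub] at hang
  obtain ⟨k, hk⟩ := hang
  have hA := Complex.arg_mem_Ioc (z - 1)
  have hB := Complex.arg_mem_Ioc z
  rcases lt_trichotomy z.im 0 with him | him | him
  · have a1 : z.arg < 0 := Complex.arg_neg_iff.2 him
    have a2 : (1 - z⁻¹).arg < 0 := Complex.arg_neg_iff.2 (by rw [hq2]; exact him)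
    have a3 : (z - 1).arg < 0 := Complex.arg_neg_iff.2 (by simpa using him)
    have hk0 : k = 0 := by
      have u : (k : ℝ) < 1 := by
        by_contra! hc
        have : 2 * Real.pi ≤ 2 * Real.pi * k := le_mul_of_one_le_right (by positivity) hc
        linarith [hA.1, hB.1]
      have l : (-1 : ℝ) < k := by
        by_contra! hc
        have : 2 * Real.pi * k ≤ 2 * Real.pi * (-1) :=
          mul_le_mul_of_nonneg_left hc (by positivity)
        linarith [hA.1, hB.1]
      have u' : k < 1 := by exact_mod_cast u
      have l' : -1 < k := by exact_mod_cast l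
      omega
    rw [hk0] at hk
    simp only [Int.cast_zero, mul_zero] at hk
    constructor <;> linarith [hA.1, hA.2]
  · have a2 : (1 - z⁻¹).arg = 0 := Complex.arg_eq_zero_iff.2 ⟨by linarith, by rw [hq2, him]⟩
    rw [a2, add_zero]; exact hB
  · have a1 : 0 ≤ z.arg := Complex.arg_nonneg_iff.2 him.le
    have a2 : 0 ≤ (1 - z⁻¹).arg := Complex.arg_nonneg_iff.2 (by rw [hq2]; exact him.le)
    have a3 : 0 ≤ (z - 1).arg := Complex.arg_nonneg_iff.2 (by simpa using him.le)
    have hk0 : k = 0 := by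
      have u : (k : ℝ) < 1 := by
        by_contra! hc
        have : 2 * Real.pi ≤ 2 * Real.pi * k := le_mul_of_one_le_right (by positivity) hc
        linarith [hA.2, hB.2]
      have l : (-1 : ℝ) < k := by
        by_contra! hc
        have : 2 * Real.pi * k ≤ 2 * Real.pi * (-1) :=
          mul_le_mul_of_nonneg_left hc (by positivity)
        linarith [hA.2, hB.2]
      have u' : k < 1 := by exact_mod_cast u
      have l' : -1 < k := by exact_mod_cast l
      omega
    rw [hk0] at hk
    simp only [Int.cast_zero, mul_zero] at hk
    constructor <;> linarith [hA.1, hA.2]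

theorem cpow_mul_sub_one_cpow {z : ℂ} (hz : ‖z‖ = 1) (h1 : z ≠ 1) (α : ℂ) :
    z ^ (1 - α) * (z - 1) ^ α = z * (1 - z⁻¹) ^ α := by
  have hz0 : z ≠ 0 := by rintro rfl; simp at hz
  have hq0 : 1 - z⁻¹ ≠ 0 := fun h => h1 (by rw [sub_eq_zero] at h; simpa using h.symm)
  have hprod : z - 1 = z * (1 - z⁻¹) := by field_simp
  rw [hprod, Complex.cpow_def_of_ne_zero hz0, Complex.cpow_def_of_ne_zero (mul_ne_zero hz0 hq0),
    Complex.cpow_def_of_ne_zero hq0, Complex.log_mul hz0 hq0 (arg_add_arg_mem_Ioc hz h1),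
    ← Complex.exp_add]
  nth_rewrite 4 [← Complex.exp_log hz0]
  rw [← Complex.exp_add]
  congr 1; ring

/-! ### The generating function of the resolvent sequence. -/

variable {X : Type*} [NormedAddCommGroup X] [NormedSpace ℂ X]

theorem commute_alphaResolvent (α : ℝ) (T : X →L[ℂ] X) (n : ℕ) :
    Commute T (alphaResolvent α T n) := by
  induction n using Nat.strong_induction_on with
  | _ n ih =>
    cases n with
    | zero => rw [alphaResolvent]; exact Commute.one_right T
    | succ n =>
      rw [alphaResolvent]
      refine ((Commute.one_right T).smul_right _).add_right ((Commute.refl T).mul_right ?_)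
      exact Commute.sum_right _ _ _ fun j _ => (ih j j.2).smul_right _

/-- The reciprocal `(1 - w)^α I - w T` of the generating function of the resolvent sequence. -/
noncomputable def genInv (α : ℝ) (T : X →L[ℂ] X) (w : ℂ) : X →L[ℂ] X :=
  ((1 - w) ^ (α : ℂ)) • (1 : X →L[ℂ] X) - w • T

theorem isUnit_genInv_of_norm_eq_one {α : ℝ} {T : X →L[ℂ] X} (hSigma : singularSet α T ⊆ {1})
    {w : ℂ} (hw : ‖w‖ = 1) (h1 : w ≠ 1) : IsUnit (genInv α T w) := by
  have hw0 : w ≠ 0 := by rintro rfl; simp at hw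
  have hz : ‖w⁻¹‖ = 1 := by simp [hw]
  have hz1 : w⁻¹ ≠ 1 := by simpa using h1
  have hreg : w⁻¹ ∈ regularSet α T := by
    by_contra hc
    exact hz1 (hSigma ⟨by simpa using hz, hc⟩)
  obtain ⟨-, U, -, hU, hunit, -⟩ := hreg
  have h := hunit _ hU
  have heq : genInv α T w = w • charOp α T w⁻¹ := by
    have := cpow_mul_sub_one_cpow hz hz1 α
    rw [charOp, Complex.ofReal_sub, Complex.ofReal_one, this, inv_inv, smul_sub, smul_smul,
      mul_inv_cancel_left₀ hw0, genInv]
  rw [heq]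
  exact h.smul (Units.mk0 w hw0)

variable [CompleteSpace X]

/-- Summing the recurrence against `w^(n+1)` turns its convolution into a Cauchy product: `F - 1 =
((1 - w)^(-α) - 1) + wTF(1 - w)^(-α)`. Multiplying by `(1 - w)^α` gives the claim. -/
theorem genInv_mul_tsum {α : ℝ} (hα : 0 < α) (T : X →L[ℂ] X) {w : ℂ} (hw : ‖w‖ < 1)
    (hs : Summable fun n => ‖w ^ n • alphaResolvent α T n‖) :
    genInv α T w * ∑' n, w ^ n • alphaResolvent α T n = 1 := by
  set S := alphaResolvent α T with hS
  set F := ∑' n, w ^ n • S n with hF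
  have hrec := ((isAlphaResolvent_iff α T S).2 rfl)
  have hk := summable_norm_kernel_mul_pow hα hw
  have hk' : Summable fun n => ‖algebraMap ℂ (X →L[ℂ] X) ((kernel α n : ℂ) * w ^ n)‖ := by
    refine Summable.of_nonneg_of_le (fun n => norm_nonneg _) (fun n => ?_)
      (hk.mul_right ‖(1 : X →L[ℂ] X)‖)
    rw [norm_algebraMap]
  have hKsum : ∑' n, algebraMap ℂ (X →L[ℂ] X) ((kernel α n : ℂ) * w ^ n)
      = algebraMap ℂ _ ((1 - w) ^ (α : ℂ))⁻¹ :=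
    ((hasSum_kernel_mul_pow hα hw).map (algebraMap ℂ (X →L[ℂ] X))
      (algebraMapCLM ℂ (X →L[ℂ] X)).continuous).tsum_eq
  have hprod := hasSum_sum_range_mul_of_summable_norm hs hk'
  rw [hKsum] at hprod
  have hK1 := hasSum_kernel_mul_pow hα hw
  have hK2 := (hasSum_nat_add_iff' 1).2 hK1
  have hF2 := (hasSum_nat_add_iff' 1).2 hs.of_norm.hasSum
  have hrhs := (hK2.smul_const (1 : X →L[ℂ] X)).add ((hprod.mul_left T).const_smul w)
  have heq : F - ∑ i ∈ Finset.range 1, w ^ i • S i =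
      (((1 - w) ^ (α : ℂ))⁻¹ - ∑ i ∈ Finset.range 1, (kernel α i : ℂ) * w ^ i) •
        (1 : X →L[ℂ] X) + w • (T * (F * algebraMap ℂ _ ((1 - w) ^ (α : ℂ))⁻¹)) := by
    refine hF2.unique (hrhs.congr_fun ?_)
    intro n
    rw [hrec.2 n]
    simp only [smul_add, Finset.mul_sum, Finset.smul_sum]
    congr 1
    · rw [smul_smul, mul_comm]
    · refine Finset.sum_congr rfl fun j hj => ?_
      have hj' : j ≤ n := Nat.lt_succ_iff.1 (Finset.mem_range.1 hj)
      rw [Algebra.algebraMap_eq_smul_one]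
      simp only [mul_smul_comm, smul_smul, mul_one]
      congr 1
      have : w ^ (n + 1) = w * (w ^ (n - j) * w ^ j) := by
        rw [← pow_add, Nat.sub_add_cancel hj', pow_succ']
      rw [this]; ring
  have hne : (1 - w) ^ (α : ℂ) ≠ 0 := by
    have : (1 : ℂ) - w ≠ 0 := fun h => by
      rw [sub_eq_zero] at h; rw [← h] at hw; simp at hw
    rw [Complex.cpow_def_of_ne_zero this]; exact Complex.exp_ne_zero _
  simp only [Finset.sum_range_one, pow_zero, one_smul, hrec.1, kernel_zero hα, Complex.ofReal_one,
    mul_one, sub_smul] at heq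
  have heq' : F = ((1 - w) ^ (α : ℂ))⁻¹ • (1 : X →L[ℂ] X)
      + ((1 - w) ^ (α : ℂ))⁻¹ • (w • (T * F)) := by
    rw [Algebra.algebraMap_eq_smul_one, mul_smul_comm, mul_one, mul_smul_comm, smul_comm] at heq
    have := eq_add_of_sub_eq heq
    refine this.trans ?_
    abel
  have h3 : ((1 - w) ^ (α : ℂ)) • F = 1 + w • (T * F) := by
    conv_lhs => rw [heq']
    rw [smul_add, smul_smul, smul_smul, mul_inv_cancel₀ hne, one_smul, one_smul]
  rw [genInv, sub_mul, smul_mul_assoc, one_mul, smul_mul_assoc, h3, add_sub_cancel_right]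

theorem tsum_mul_genInv {α : ℝ} (hα : 0 < α) (T : X →L[ℂ] X) {w : ℂ} (hw : ‖w‖ < 1)
    (hs : Summable fun n => ‖w ^ n • alphaResolvent α T n‖) :
    (∑' n, w ^ n • alphaResolvent α T n) * genInv α T w = 1 := by
  have hc : Commute (∑' n, w ^ n • alphaResolvent α T n) T :=
    Commute.tsum_left _ fun n => ((commute_alphaResolvent α T n).smul_right _).symm
  have : Commute (∑' n, w ^ n • alphaResolvent α T n) (genInv α T w) :=
    ((Commute.one_right _).smul_right _).sub_right (hc.smul_right _)
  rw [this.eq, genInv_mul_tsum hα T hw hs]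

theorem continuousOn_inverse_genInv {α : ℝ} (hα : 0 < α) {T : X →L[ℂ] X}
    (hSigma : singularSet α T ⊆ {1})
    (hs : ∀ w : ℂ, ‖w‖ < 1 → Summable fun n => ‖w ^ n • alphaResolvent α T n‖) :
    ContinuousOn (fun w => Ring.inverse (genInv α T w)) (Metric.closedBall 0 1 \ {1}) := by
  rintro w ⟨hw, h1⟩
  rw [mem_closedBall_zero_iff] at hw
  have h1' : w ≠ 1 := h1
  have hu : IsUnit (genInv α T w) := by
    rcases hw.lt_or_eq with h | h
    · exact ⟨⟨_, _, genInv_mul_tsum hα T h (hs w h), tsum_mul_genInv hα T h (hs w h)⟩, rfl⟩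
    · exact isUnit_genInv_of_norm_eq_one hSigma h h1'
  obtain ⟨u, hu⟩ := hu
  -- On the closed disc `re w ≤ 1`, with equality only at `w = 1`, so the branch cut of the power is
  -- met only there.
  have hslit : 1 - w ∈ Complex.slitPlane := by
    rw [Complex.mem_slitPlane_iff]
    by_contra! hc
    simp only [Complex.sub_re, Complex.one_re, Complex.sub_im, Complex.one_im, zero_sub,
      neg_eq_zero] at hc
    have : w.re ≤ 1 := (Complex.re_le_norm w).trans hw
    exact h1' (Complex.ext (by simp; linarith) (by simp [hc.2]))
  have hcont : ContinuousAt (fun w => genInv α T w) w := by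
    unfold genInv
    have : ContinuousAt (fun w : ℂ => (1 - w) ^ (α : ℂ)) w :=
      ContinuousAt.cpow (by fun_prop) continuousAt_const hslit
    fun_prop
  refine ContinuousAt.continuousWithinAt ?_
  refine ContinuousAt.comp (g := Ring.inverse) ?_ hcont
  rw [← hu]
  exact NormedRing.inverse_continuousAt u

theorem hasSum_inverse_genInv {α : ℝ} (hα : 0 < α) (T : X →L[ℂ] X) {w : ℂ} (hw : ‖w‖ < 1)
    (hs : Summable fun n => ‖w ^ n • alphaResolvent α T n‖) :
    HasSum (fun n => w ^ n • alphaResolvent α T n) (Ring.inverse (genInv α T w)) := by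
  have : Ring.inverse (genInv α T w) = ∑' n, w ^ n • alphaResolvent α T n :=
    Ring.inverse_unit ⟨_, _, genInv_mul_tsum hα T hw hs, tsum_mul_genInv hα T hw hs⟩
  rw [this]
  exact hs.of_norm.hasSum

end FracKT

/-! ### Weighted convolutions and samples of a Schwartz function. -/

namespace FracKT

open MeasureTheory intervalIntegral
open scoped FourierTransform SchwartzMap

theorem summable_add_one_pow_mul_pow (ν : ℕ) {r : ℝ} (h0 : 0 ≤ r) (h1 : r < 1) :
    Summable fun m : ℕ => ((m : ℝ) + 1) ^ ν * r ^ m := by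
  have hr : ‖r‖ < 1 := by rwa [Real.norm_of_nonneg h0]
  refine Summable.of_nonneg_of_le (fun m => by positivity) (fun m => ?_)
    (((summable_pow_mul_geometric_of_norm_lt_one ν hr).add
      (summable_geometric_of_lt_one h0 h1)).mul_left (2 ^ (ν - 1)))
  have := add_pow_le (Nat.cast_nonneg (α := ℝ) m) zero_le_one ν
  rw [one_pow] at this
  calc ((m : ℝ) + 1) ^ ν * r ^ m ≤ (2 ^ (ν - 1) * ((m : ℝ) ^ ν + 1)) * r ^ m := by gcongr
    _ = _ := by ring

variable {E : Type*} [NormedAddCommGroup E] [NormedSpace ℂ E]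

theorem summable_norm_pow_smul {x : ℕ → E} {C : ℝ} {ν : ℕ}
    (hx : ∀ m, ‖x m‖ ≤ C * ((m : ℝ) + 1) ^ ν) {w : ℂ} (hw : ‖w‖ < 1) :
    Summable fun m => ‖w ^ m • x m‖ := by
  refine Summable.of_nonneg_of_le (fun m => norm_nonneg _) (fun m => ?_)
    ((summable_add_one_pow_mul_pow ν (norm_nonneg w) hw).mul_left C)
  rw [norm_smul, norm_pow]
  calc ‖w‖ ^ m * ‖x m‖ ≤ ‖w‖ ^ m * (C * ((m : ℝ) + 1) ^ ν) := by gcongr; exact hx m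
    _ = _ := by ring

theorem injective_natCast_sub (n : ℕ) : Function.Injective fun m : ℕ => (n : ℤ) - m := by
  intro a b h
  simpa using h

theorem natCast_add_one_le (n m : ℕ) :
    (m : ℝ) + 1 ≤ (n : ℝ) + 1 + |(((n : ℤ) - m : ℤ) : ℝ)| := by
  have h := neg_abs_le (((n : ℤ) - m : ℤ) : ℝ)
  push_cast at h ⊢
  linarith

theorem summable_norm_mul_add_one_pow {b : ℤ → ℂ} {ν : ℕ}
    (hb : Summable fun j : ℤ => ‖b j‖ * (1 + |(j : ℝ)|) ^ ν) (n : ℕ) :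
    Summable fun m : ℕ => ‖b (n - m)‖ * ((m : ℝ) + 1) ^ ν := by
  have h1 := (hb.comp_injective (injective_natCast_sub n)).mul_left (((n : ℝ) + 1) ^ ν)
  refine Summable.of_nonneg_of_le (fun m => by positivity) (fun m => ?_) h1
  have h2 := natCast_add_one_le n m
  simp only [Function.comp]
  have h3 : (m : ℝ) + 1 ≤ ((n : ℝ) + 1) * (1 + |(((n : ℤ) - m : ℤ) : ℝ)|) := by
    refine h2.trans ?_
    have := mul_nonneg (Nat.cast_nonneg (α := ℝ) n) (abs_nonneg (((n : ℤ) - m : ℤ) : ℝ))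
    nlinarith
  calc ‖b (n - m)‖ * ((m : ℝ) + 1) ^ ν
      ≤ ‖b (n - m)‖ * (((n : ℝ) + 1) * (1 + |(((n : ℤ) - m : ℤ) : ℝ)|)) ^ ν := by gcongr
    _ = _ := by rw [mul_pow]; ring

theorem norm_smul_le_of_growth {x : ℕ → E} {C : ℝ} {ν : ℕ}
    (hx : ∀ m, ‖x m‖ ≤ C * ((m : ℝ) + 1) ^ ν) (c : ℂ) (m : ℕ) :
    ‖c • x m‖ ≤ C * (‖c‖ * ((m : ℝ) + 1) ^ ν) := by
  rw [norm_smul]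
  calc ‖c‖ * ‖x m‖ ≤ ‖c‖ * (C * ((m : ℝ) + 1) ^ ν) := by gcongr; exact hx m
    _ = _ := by ring

theorem summable_norm_convolution {x : ℕ → E} {C : ℝ} {ν : ℕ}
    (hx : ∀ m, ‖x m‖ ≤ C * ((m : ℝ) + 1) ^ ν) {b : ℤ → ℂ}
    (hb : Summable fun j : ℤ => ‖b j‖ * (1 + |(j : ℝ)|) ^ ν) (n : ℕ) :
    Summable fun m : ℕ => ‖b (n - m) • x m‖ :=
  Summable.of_nonneg_of_le (fun _ => norm_nonneg _) (fun m => norm_smul_le_of_growth hx _ m)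
    ((summable_norm_mul_add_one_pow hb n).mul_left C)

/-- Only the unweighted `ℓ¹` norm of `b` enters the constant: with `j = n - m`, the relative weight
is at most `((n + 1 + |j|)/(n + 1))^ν`, which tends to `1` for fixed `j` and is dominated by `(1 +
|j|)^ν`. -/
theorem eventually_norm_convolution_le {x : ℕ → E} {C : ℝ} {ν : ℕ} (hC : 0 ≤ C)
    (hx : ∀ m, ‖x m‖ ≤ C * ((m : ℝ) + 1) ^ ν) {b : ℤ → ℂ}
    (hb : Summable fun j : ℤ => ‖b j‖ * (1 + |(j : ℝ)|) ^ ν) {ε : ℝ}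
    (hε : C * ∑' j, ‖b j‖ < ε) :
    ∀ᶠ n : ℕ in atTop, ‖∑' m : ℕ, b (n - m) • x m‖ ≤ ε * ((n : ℝ) + 1) ^ ν := by
  have hbound : ∀ (n : ℕ) (j : ℤ), ‖b j‖ * (((n : ℝ) + 1 + |(j : ℝ)|) / (n + 1)) ^ ν
      ≤ ‖b j‖ * (1 + |(j : ℝ)|) ^ ν := fun n j => by
    gcongr
    rw [div_le_iff₀ (by positivity)]
    have := mul_nonneg (Nat.cast_nonneg (α := ℝ) n) (abs_nonneg (j : ℝ))
    nlinarith
  have hlim : Tendsto (fun n : ℕ => ∑' j : ℤ, ‖b j‖ * (((n : ℝ) + 1 + |(j : ℝ)|) / (n + 1)) ^ ν)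
      atTop (𝓝 (∑' j, ‖b j‖)) := by
    refine tendsto_tsum_of_dominated_convergence hb (fun j => ?_)
      (Eventually.of_forall fun n j => ?_)
    · have h1 : Tendsto (fun n : ℕ => 1 + |(j : ℝ)| / ((n : ℝ) + 1)) atTop (𝓝 (1 + 0)) :=
        tendsto_const_nhds.add (tendsto_const_nhds.div_atTop
          (tendsto_atTop_add_const_right _ _ tendsto_natCast_atTop_atTop))
      have h2 := (h1.pow ν).const_mul ‖b j‖
      simp only [add_zero, one_pow, mul_one] at h2
      refine h2.congr fun n => ?_
      have : (n : ℝ) + 1 ≠ 0 := by positivity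
      rw [add_div, div_self this]
    · rw [Real.norm_of_nonneg (by positivity)]
      exact hbound n j
  have hev := (hlim.const_mul C).eventually (gt_mem_nhds hε)
  filter_upwards [hev] with n hn
  have hs1 : Summable fun j : ℤ => ‖b j‖ * (((n : ℝ) + 1 + |(j : ℝ)|) / (n + 1)) ^ ν :=
    Summable.of_nonneg_of_le (fun j => by positivity) (hbound n) hb
  have hs2 := summable_norm_convolution hx hb n
  calc ‖∑' m : ℕ, b (n - m) • x m‖ ≤ ∑' m : ℕ, ‖b (n - m) • x m‖ := norm_tsum_le_tsum_norm hs2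
    _ ≤ ∑' j : ℤ, C * ((n : ℝ) + 1) ^ ν *
          (‖b j‖ * (((n : ℝ) + 1 + |(j : ℝ)|) / (n + 1)) ^ ν) := by
        refine hs2.tsum_le_tsum_of_inj _ (injective_natCast_sub n) (fun j _ => by positivity)
          (fun m => ?_) (hs1.mul_left _)
        refine (norm_smul_le_of_growth hx _ m).trans ?_
        have h2 := natCast_add_one_le n m
        have h3 : (n : ℝ) + 1 ≠ 0 := by positivity
        calc C * (‖b (n - m)‖ * ((m : ℝ) + 1) ^ ν)
            ≤ C * (‖b (n - m)‖ * ((n : ℝ) + 1 + |(((n : ℤ) - m : ℤ) : ℝ)|) ^ ν) := by gcongr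
          _ = _ := by rw [div_pow]; field_simp
    _ = (C * ∑' j : ℤ, ‖b j‖ * (((n : ℝ) + 1 + |(j : ℝ)|) / (n + 1)) ^ ν)
          * ((n : ℝ) + 1) ^ ν := by rw [tsum_mul_left]; ring
    _ ≤ ε * ((n : ℝ) + 1) ^ ν := by gcongr

/-- A Schwartz function equal to `1` on `[-1, 1]` and to `0` outside `(-2, 2)`. -/
theorem exists_schwartz_bump : ∃ φ : 𝓢(ℝ, ℂ), (∀ t, |t| ≤ 1 → φ t = 1) ∧
    ∀ t, 2 ≤ |t| → φ t = 0 := by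
  let f : ContDiffBump (0 : ℝ) := ⟨1, 2, one_pos, one_lt_two⟩
  have h1 : HasCompactSupport fun t => (f t : ℂ) :=
    f.hasCompactSupport.comp_left (g := Complex.ofReal) (by simp)
  have h2 : ContDiff ℝ (⊤ : ℕ∞) fun t => (f t : ℂ) := Complex.ofRealCLM.contDiff.comp f.contDiff
  refine ⟨h1.toSchwartzMap h2, fun t ht => ?_, fun t ht => ?_⟩
  · change ((f t : ℝ) : ℂ) = 1
    rw [f.one_of_mem_closedBall (by simpa [f] using ht)]; simp
  · change ((f t : ℝ) : ℂ) = 0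
    rw [f.zero_of_le_dist (by simpa [f] using ht)]; simp

theorem summable_schwartz_samples (ψ : 𝓢(ℝ, ℂ)) {δ : ℝ} (h0 : 0 < δ) (h1 : δ ≤ 1) (ν : ℕ) :
    Summable fun j : ℤ => ‖(δ : ℂ) * ψ (δ * j)‖ * (1 + |(j : ℝ)|) ^ ν := by
  -- Decay of order `ν + 2` pays for the weight of order `ν` and leaves a summable inverse square.
  set M := 2 ^ (ν + 2) * ((Finset.Iic (ν + 2, 0)).sup
    fun m => SchwartzMap.seminorm ℝ m.1 m.2) ψ with hM
  have hdec : ∀ t : ℝ, (1 + |t|) ^ (ν + 2) * ‖ψ t‖ ≤ M := fun t => by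
    have := SchwartzMap.one_add_le_sup_seminorm_apply (𝕜 := ℝ) (m := (ν + 2, 0))
      le_rfl le_rfl ψ t
    simpa using this
  have hs : Summable fun j : ℤ => 1 / (1 + |(j : ℝ)|) ^ 2 := by
    have hz : Summable fun j : ℤ => 1 / (j : ℝ) ^ 2 :=
      Real.summable_one_div_int_pow.2 one_lt_two
    refine (hz.add (summable_of_ne_finset_zero (s := {0})
      (f := fun j : ℤ => if j = 0 then (1 : ℝ) else 0) (by simp_all))).of_nonneg_of_le
      (fun j => by positivity) (fun j => ?_)
    by_cases hj : j = 0
    · simp [hj]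
    · have : 0 < |(j : ℝ)| := by positivity
      rw [if_neg hj, add_zero, ← sq_abs (j : ℝ)]
      gcongr
      linarith
  refine Summable.of_nonneg_of_le (fun j => by positivity) (fun j => ?_)
    (hs.mul_left (δ * (M * (1 / δ) ^ (ν + 2))))
  have hj : 1 + |(j : ℝ)| ≤ 1 / δ * (1 + |δ * j|) := by
    rw [abs_mul, abs_of_pos h0, mul_add, mul_one, one_div, inv_mul_cancel_left₀ h0.ne']
    gcongr
    exact (one_le_inv₀ h0).2 h1
  rw [norm_mul, Complex.norm_real, Real.norm_of_nonneg h0.le, mul_one_div,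
    le_div_iff₀ (by positivity)]
  calc δ * ‖ψ (δ * j)‖ * (1 + |(j : ℝ)|) ^ ν * (1 + |(j : ℝ)|) ^ 2
      = δ * (‖ψ (δ * j)‖ * (1 + |(j : ℝ)|) ^ (ν + 2)) := by ring
    _ ≤ δ * (‖ψ (δ * j)‖ * (1 / δ * (1 + |δ * j|)) ^ (ν + 2)) := by gcongr
    _ = δ * ((1 + |δ * j|) ^ (ν + 2) * ‖ψ (δ * j)‖ * (1 / δ) ^ (ν + 2)) := by
        rw [mul_pow]; ring
    _ ≤ _ := by gcongr; exact hdec _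

/-- Each increment is an integral of `deriv ψ` over a cell of length `δ`, and the cells tile the
line. The remaining factor `δ` is the gain used in the Tauberian theorem. -/
theorem tsum_norm_sub_schwartz_samples_le (ψ : 𝓢(ℝ, ℂ)) {δ : ℝ} (h0 : 0 < δ) :
    ∑' j : ℤ, ‖(δ : ℂ) * ψ (δ * (j + 1 : ℤ)) - δ * ψ (δ * j)‖ ≤ δ * ∫ t, ‖deriv ψ t‖ := by
  have hint : Integrable fun t => ‖deriv ψ t‖ := (SchwartzMap.derivCLM ℝ ℂ ψ).integrable.norm
  have hdisj : Pairwise (Function.onFun Disjoint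
      fun j : ℤ => Set.Ioc (j • δ) ((j + 1) • δ)) := by
    simpa using Set.pairwise_disjoint_Ioc_add_zsmul 0 δ
  have hsum := hasSum_integral_iUnion (μ := volume) (f := fun t => ‖deriv ψ t‖)
    (fun j : ℤ => measurableSet_Ioc (a := j • δ) (b := (j + 1) • δ)) hdisj hint.integrableOn
  rw [iUnion_Ioc_zsmul h0, setIntegral_univ] at hsum
  rw [← hsum.tsum_eq, ← tsum_mul_left]
  have hle : ∀ j : ℤ, ‖(δ : ℂ) * ψ (δ * (j + 1 : ℤ)) - δ * ψ (δ * j)‖ ≤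
      δ * ∫ t in Set.Ioc (j • δ) ((j + 1) • δ), ‖deriv ψ t‖ := fun j => by
    have hjle : j • δ ≤ (j + 1) • δ := by rw [add_smul, one_smul]; linarith
    have hftc : ∫ t in (j • δ)..((j + 1) • δ), deriv ψ t = ψ ((j + 1) • δ) - ψ (j • δ) :=
      integral_eq_sub_of_hasDerivAt (fun t _ => ψ.differentiableAt.hasDerivAt)
        (SchwartzMap.derivCLM ℝ ℂ ψ).integrable.intervalIntegrable
    rw [← mul_sub, norm_mul, Complex.norm_real, Real.norm_of_nonneg h0.le,
      ← integral_of_le hjle]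
    have e1 : δ * ((j + 1 : ℤ) : ℝ) = (j + 1) • δ := by rw [zsmul_eq_mul, mul_comm]
    have e2 : δ * (j : ℝ) = j • δ := by rw [zsmul_eq_mul, mul_comm]
    rw [e1, e2, ← hftc]
    gcongr
    exact norm_integral_le_integral_norm hjle
  exact (Summable.of_nonneg_of_le (fun _ => norm_nonneg _) hle
    (hsum.summable.mul_left δ)).tsum_le_tsum hle (hsum.summable.mul_left δ)

theorem integral_fourierChar_neg_int_mul (k : ℤ) :
    ∫ θ in (-(1 / 2) : ℝ)..(1 / 2), (𝐞 (-(θ * k)) : ℂ) = if k = 0 then 1 else 0 := by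
  split_ifs with hk
  · simp [hk]; norm_num
  · have hc : -(2 * Real.pi * k * Complex.I) ≠ 0 := by
      simp [hk, Real.pi_ne_zero]
    have := integral_exp_mul_complex (a := -(1 / 2)) (b := 1 / 2) hc
    have hfun : ∀ θ : ℝ, (𝐞 (-(θ * k)) : ℂ) =
        Complex.exp (-(2 * Real.pi * k * Complex.I) * θ) := fun θ => by
      rw [Real.fourierChar_apply]; congr 1; push_cast; ring
    simp_rw [hfun]
    rw [this, div_eq_zero_iff]
    left
    rw [sub_eq_zero, Complex.exp_eq_exp_iff_exists_int]
    exact ⟨-k, by push_cast; ring⟩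

/-- Since `2δ ≤ 1/4`, the rescaled bump is supported inside one period, so its Fourier coefficients
are samples of its Fourier transform on the line. -/
theorem integral_one_sub_bump_mul_fourierChar {φ : 𝓢(ℝ, ℂ)} (hφ : ∀ t, 2 ≤ |t| → φ t = 0)
    {δ : ℝ} (h0 : 0 < δ) (h1 : δ ≤ 1 / 8) (k : ℤ) :
    ∫ θ in (-(1 / 2) : ℝ)..(1 / 2), (1 - φ (θ / δ)) * (𝐞 (-(θ * k)) : ℂ) =
      (if k = 0 then 1 else 0) - δ * (𝓕 φ) (δ * k) := by
  have hcont : Continuous fun θ : ℝ => (𝐞 (-(θ * k)) : ℂ) := by fun_prop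
  have hφc : Continuous fun θ : ℝ => φ (θ / δ) := φ.continuous.comp (by fun_prop)
  have hprod : Continuous fun θ : ℝ => φ (θ / δ) * (𝐞 (-(θ * k)) : ℂ) := hφc.mul hcont
  simp_rw [sub_mul, one_mul]
  rw [integral_sub (hcont.intervalIntegrable _ _) (hprod.intervalIntegrable _ _),
    integral_fourierChar_neg_int_mul]
  congr 1
  rw [integral_eq_integral_of_support_subset, SchwartzMap.fourier_coe, Real.fourier_real_eq]
  · have := Measure.integral_comp_div
      (fun t : ℝ => (𝐞 (-(t * (δ * k))) : ℂ) * φ t) δ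
    rw [abs_of_pos h0] at this
    simp only [Circle.smul_def, smul_eq_mul]
    rw [← Complex.real_smul, ← this]
    congr 1
    ext θ
    rw [mul_comm]
    congr 4
    field_simp
  · intro θ hθ
    have : φ (θ / δ) ≠ 0 := left_ne_zero_of_mul hθ
    have h2 : |θ / δ| < 2 := by
      by_contra! hc
      exact this (hφ _ hc)
    rw [abs_div, abs_of_pos h0, div_lt_iff₀ h0, abs_lt] at h2
    constructor <;> linarith [h2.1, h2.2]

end FracKT

/-! ### The Tauberian theorem, by Fourier analysis on the circle. -/

namespace FracKT

open MeasureTheory intervalIntegral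
open scoped FourierTransform SchwartzMap

variable {E : Type*} [NormedAddCommGroup E] [NormedSpace ℂ E]

/-- Riemann–Lebesgue; for non-integrable `f` the integrals are `0` by convention. -/
theorem tendsto_integral_fourierChar_nat (f : ℝ → E) :
    Tendsto (fun n : ℕ => ∫ θ in (-(1 / 2) : ℝ)..(1 / 2), (𝐞 (-(θ * n)) : ℂ) • f θ) atTop
      (𝓝 0) := by
  have h := (Real.tendsto_integral_exp_smul_cocompact
    ((Set.Ioc (-(1 / 2) : ℝ) (1 / 2)).indicator f)).comp
    ((tendsto_natCast_atTop_atTop (R := ℝ)).mono_right atTop_le_cocompact)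
  refine h.congr fun n => ?_
  rw [integral_of_le (by norm_num), ← MeasureTheory.integral_indicator measurableSet_Ioc]
  simp only [Function.comp]
  congr 1
  ext θ
  by_cases hθ : θ ∈ Set.Ioc (-(1 / 2) : ℝ) (1 / 2)
  · rw [Set.indicator_of_mem hθ, Set.indicator_of_mem hθ, Circle.smul_def]
  · rw [Set.indicator_of_notMem hθ, Set.indicator_of_notMem hθ, smul_zero]

variable [CompleteSpace E]

theorem fourierChar_neg_mul_sub (θ : ℝ) (n m : ℕ) :
    (𝐞 (-(θ * (((n : ℤ) - m : ℤ) : ℝ))) : ℂ) = (𝐞 (-(θ * n)) : ℂ) * (𝐞 θ : ℂ) ^ m := by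
  simp only [Real.fourierChar_apply]
  rw [← Complex.exp_nat_mul, ← Complex.exp_add]
  congr 1
  push_cast
  ring

theorem hasSum_integral_fourierChar_smul {x : ℕ → E} {C : ℝ} {ν : ℕ}
    (hx : ∀ m, ‖x m‖ ≤ C * ((m : ℝ) + 1) ^ ν) {G : ℂ → E}
    (hG : ∀ w : ℂ, ‖w‖ < 1 → HasSum (fun m => w ^ m • x m) (G w))
    {h : ℝ → ℂ} (hh : Continuous h) (n : ℕ) {r : ℝ} (h0 : 0 ≤ r) (h1 : r < 1) :
    HasSum (fun m : ℕ => (∫ θ in (-(1 / 2) : ℝ)..(1 / 2),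
        h θ * (𝐞 (-(θ * (((n : ℤ) - m : ℤ) : ℝ))) : ℂ)) • (r : ℂ) ^ m • x m)
      (∫ θ in (-(1 / 2) : ℝ)..(1 / 2), (h θ * (𝐞 (-(θ * n)) : ℂ)) • G (r * (𝐞 θ : ℂ))) := by
  have hr : ‖(r : ℂ)‖ < 1 := by rwa [Complex.norm_real, Real.norm_of_nonneg h0]
  have hs := summable_norm_pow_smul hx hr
  obtain ⟨H, hH⟩ := isCompact_uIcc.exists_bound_of_continuousOn (f := h)
    (s := Set.uIcc (-(1 / 2) : ℝ) (1 / 2)) hh.continuousOn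
  have key : HasSum (fun m : ℕ => ∫ θ in (-(1 / 2) : ℝ)..(1 / 2),
        (h θ * (𝐞 (-(θ * (((n : ℤ) - m : ℤ) : ℝ))) : ℂ)) • (r : ℂ) ^ m • x m)
      (∫ θ in (-(1 / 2) : ℝ)..(1 / 2), (h θ * (𝐞 (-(θ * n)) : ℂ)) • G (r * (𝐞 θ : ℂ))) := by
    refine hasSum_integral_of_dominated_convergence (fun m _ => H * ‖(r : ℂ) ^ m • x m‖)
      (fun m => ?_) (fun m => ?_) ?_ ?_ ?_
    · refine Continuous.aestronglyMeasurable ?_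
      have : Continuous fun θ : ℝ => (𝐞 (-(θ * (((n : ℤ) - m : ℤ) : ℝ))) : ℂ) := by fun_prop
      exact (hh.mul this).smul continuous_const
    · refine Eventually.of_forall fun θ hθ => ?_
      rw [norm_smul, norm_mul, Circle.norm_coe, mul_one]
      gcongr
      exact hH θ (Set.uIoc_subset_uIcc hθ)
    · exact Eventually.of_forall fun θ _ => hs.mul_left H
    · exact intervalIntegrable_const
    · refine Eventually.of_forall fun θ _ => ?_
      have hw : ‖(r : ℂ) * (𝐞 θ : ℂ)‖ < 1 := by rwa [norm_mul, Circle.norm_coe, mul_one]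
      refine ((hG _ hw).const_smul (h θ * (𝐞 (-(θ * n)) : ℂ))).congr_fun ?_
      intro m
      rw [fourierChar_neg_mul_sub, mul_pow, smul_smul, smul_smul]
      congr 1
      ring
  refine key.congr_fun ?_
  intro m
  rw [intervalIntegral.integral_smul_const]

theorem fourierChar_eq_one_imp {θ : ℝ} (h : (𝐞 θ : ℂ) = 1) : ∃ n : ℤ, θ = n := by
  rw [Real.fourierChar_apply, Complex.exp_eq_one_iff] at h
  obtain ⟨n, hn⟩ := h
  refine ⟨n, ?_⟩
  have h2 : (2 * Real.pi * Complex.I : ℂ) ≠ 0 := by simp [Real.pi_ne_zero]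
  have : (2 * Real.pi * Complex.I : ℂ) * θ = (2 * Real.pi * Complex.I) * n := by
    rw [← mul_comm (n : ℂ), ← hn]; push_cast; ring
  exact_mod_cast mul_left_cancel₀ h2 this

/-- The values `r e^{2πiθ}` with `0 ≤ r ≤ 1` and `η ≤ |θ| ≤ 1/2` avoid the point `1`. -/
theorem mul_fourierChar_mem {η : ℝ} (hη : 0 < η) {r θ : ℝ} (h0 : 0 ≤ r) (h1 : r ≤ 1)
    (h2 : η ≤ |θ|) (h3 : |θ| ≤ 1 / 2) :
    (r : ℂ) * (𝐞 θ : ℂ) ∈ Metric.closedBall (0 : ℂ) 1 \ {1} := by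
  have hn : ‖(r : ℂ) * (𝐞 θ : ℂ)‖ = r := by
    rw [norm_mul, Circle.norm_coe, mul_one, Complex.norm_real, Real.norm_of_nonneg h0]
  refine ⟨by rw [mem_closedBall_zero_iff, hn]; exact h1, fun h => ?_⟩
  have h : (r : ℂ) * (𝐞 θ : ℂ) = 1 := h
  rw [h, norm_one] at hn
  rw [← hn, Complex.ofReal_one, one_mul] at h
  obtain ⟨n, rfl⟩ := fourierChar_eq_one_imp h
  rcases eq_or_ne n 0 with rfl | hn0
  · simp at h2; linarith
  · have : (1 : ℝ) ≤ |(n : ℝ)| := by exact_mod_cast Int.one_le_abs hn0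
    linarith

/-- On circles of radius `r < 1` the identity is termwise integration. As `r → 1`, the left side
converges by absolute summability of the convolution, the right side by dominated convergence,
because `h` vanishes near the point where `G` is uncontrolled. -/
theorem tsum_convolution_eq_integral {x : ℕ → E} {C : ℝ} {ν : ℕ}
    (hx : ∀ m, ‖x m‖ ≤ C * ((m : ℝ) + 1) ^ ν) {G : ℂ → E}
    (hG : ∀ w : ℂ, ‖w‖ < 1 → HasSum (fun m => w ^ m • x m) (G w))
    (hGc : ContinuousOn G (Metric.closedBall 0 1 \ {1}))
    {h : ℝ → ℂ} (hh : Continuous h) {η : ℝ} (hη : 0 < η) (hh0 : ∀ θ, |θ| < η → h θ = 0)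
    {c : ℤ → ℂ} (hc : ∀ k : ℤ, ∫ θ in (-(1 / 2) : ℝ)..(1 / 2), h θ * (𝐞 (-(θ * k)) : ℂ) = c k)
    (hcs : Summable fun j : ℤ => ‖c j‖ * (1 + |(j : ℝ)|) ^ ν) (n : ℕ) :
    ∑' m : ℕ, c (n - m) • x m =
      ∫ θ in (-(1 / 2) : ℝ)..(1 / 2), (h θ * (𝐞 (-(θ * n)) : ℂ)) • G (𝐞 θ : ℂ) := by
  have hu : Set.uIcc (-(1 / 2) : ℝ) (1 / 2) = Set.Icc (-(1 / 2)) (1 / 2) :=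
    Set.uIcc_of_le (by norm_num)
  have hint : ∀ θ ∈ Set.uIoc (-(1 / 2) : ℝ) (1 / 2), |θ| ≤ 1 / 2 := fun θ hθ => by
    have := Set.uIoc_subset_uIcc hθ
    rw [hu] at this
    exact abs_le.2 this
  have hmem : ∀ᶠ r : ℝ in 𝓝[<] 1, 0 < r ∧ r < 1 := by
    have : Set.Ioo (0 : ℝ) 1 ∈ 𝓝[<] 1 := Ioo_mem_nhdsLT one_pos
    exact this
  have hr1 : Tendsto (fun r : ℝ => (r : ℂ)) (𝓝[<] 1) (𝓝 1) := by
    have : Tendsto (fun r : ℝ => (r : ℂ)) (𝓝 1) (𝓝 ((1 : ℝ) : ℂ)) :=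
      Complex.continuous_ofReal.tendsto 1
    rw [Complex.ofReal_one] at this
    exact this.mono_left nhdsWithin_le_nhds
  have hL : Tendsto (fun r : ℝ => ∑' m : ℕ, c (n - m) • (r : ℂ) ^ m • x m) (𝓝[<] 1)
      (𝓝 (∑' m : ℕ, c (n - m) • x m)) := by
    refine tendsto_tsum_of_dominated_convergence (summable_norm_convolution hx hcs n)
      (fun m => ?_) ?_
    · have := ((hr1.pow m).smul_const (x m)).const_smul (c (n - m))
      simpa using this
    · filter_upwards [hmem] with r hr m
      rw [smul_comm, norm_smul]
      refine mul_le_of_le_one_left (norm_nonneg _) ?_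
      rw [norm_pow, Complex.norm_real, Real.norm_of_nonneg hr.1.le]
      exact pow_le_one₀ hr.1.le hr.2.le
  obtain ⟨H, hH⟩ := isCompact_uIcc.exists_bound_of_continuousOn (f := h)
    (s := Set.uIcc (-(1 / 2) : ℝ) (1 / 2)) hh.continuousOn
  have hcp : Continuous fun p : ℝ × ℝ => (p.1 : ℂ) * (𝐞 p.2 : ℂ) := by fun_prop
  have hK : IsCompact (Set.Icc (0 : ℝ) 1 ×ˢ (Set.Icc (-(1 / 2) : ℝ) (1 / 2) ∩ {θ | η ≤ |θ|})) :=
    isCompact_Icc.prod (isCompact_Icc.inter_right (isClosed_le continuous_const continuous_abs))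
  -- A bound for `G` uniform in `r`, on a compact region that avoids `1`.
  obtain ⟨M, hM⟩ := hK.exists_bound_of_continuousOn
    (f := fun p : ℝ × ℝ => G ((p.1 : ℂ) * (𝐞 p.2 : ℂ)))
    (hGc.comp hcp.continuousOn fun p hp =>
      mul_fourierChar_mem hη hp.1.1 hp.1.2 hp.2.2 (abs_le.2 hp.2.1))
  have hR : Tendsto (fun r : ℝ => ∫ θ in (-(1 / 2) : ℝ)..(1 / 2),
      (h θ * (𝐞 (-(θ * n)) : ℂ)) • G (r * (𝐞 θ : ℂ))) (𝓝[<] 1)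
      (𝓝 (∫ θ in (-(1 / 2) : ℝ)..(1 / 2), (h θ * (𝐞 (-(θ * n)) : ℂ)) • G (𝐞 θ : ℂ))) := by
    refine tendsto_integral_filter_of_dominated_convergence (fun _ => |H| * |M|) ?_ ?_
      intervalIntegrable_const ?_
    · filter_upwards [hmem] with r hr
      refine Continuous.aestronglyMeasurable ?_
      have h1 : Continuous fun θ : ℝ => (𝐞 (-(θ * n)) : ℂ) := by fun_prop
      have h2 : Continuous fun θ : ℝ => (r : ℂ) * (𝐞 θ : ℂ) := by fun_prop
      have h3 : ∀ θ : ℝ, (r : ℂ) * (𝐞 θ : ℂ) ∈ Metric.closedBall (0 : ℂ) 1 \ {1} := fun θ => by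
        have hn : ‖(r : ℂ) * (𝐞 θ : ℂ)‖ < 1 := by
          rw [norm_mul, Circle.norm_coe, mul_one, Complex.norm_real, Real.norm_of_nonneg hr.1.le]
          exact hr.2
        refine ⟨by rw [mem_closedBall_zero_iff]; exact hn.le, fun h => ?_⟩
        have h : (r : ℂ) * (𝐞 θ : ℂ) = 1 := h
        rw [h, norm_one] at hn
        exact lt_irrefl _ hn
      exact (hh.mul h1).smul (hGc.comp_continuous h2 h3)
    · filter_upwards [hmem] with r hr
      refine Eventually.of_forall fun θ hθ => ?_
      rcases lt_or_ge |θ| η with hl | hl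
      · rw [hh0 θ hl, zero_mul, zero_smul, norm_zero]
        positivity
      · rw [norm_smul, norm_mul, Circle.norm_coe, mul_one]
        gcongr
        · exact (hH θ (Set.uIoc_subset_uIcc hθ)).trans (le_abs_self H)
        · exact (hM (r, θ) ⟨⟨hr.1.le, hr.2.le⟩, abs_le.1 (hint θ hθ), hl⟩).trans (le_abs_self M)
    · refine Eventually.of_forall fun θ hθ => ?_
      rcases lt_or_ge |θ| η with hl | hl
      · simp only [hh0 θ hl, zero_mul, zero_smul]
        exact tendsto_const_nhds
      · refine Tendsto.const_smul ?_ _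
        have h1 : (𝐞 θ : ℂ) ∈ Metric.closedBall (0 : ℂ) 1 \ {1} := by
          simpa using mul_fourierChar_mem hη zero_le_one le_rfl hl (hint θ hθ)
        refine (hGc _ h1).tendsto.comp (tendsto_nhdsWithin_iff.2 ⟨?_, ?_⟩)
        · simpa using hr1.mul_const (𝐞 θ : ℂ)
        · filter_upwards [hmem] with r hr
          exact mul_fourierChar_mem hη hr.1.le hr.2.le hl (hint θ hθ)
  refine tendsto_nhds_unique hL (hR.congr' ?_)
  filter_upwards [hmem] with r hr
  rw [← (hasSum_integral_fourierChar_smul hx hG hh n hr.1.le hr.2).tsum_eq]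
  exact tsum_congr fun m => by rw [hc]

/-- **Tauberian theorem**: a sequence of polynomial growth whose generating function extends
continuously to the closed unit disc without the point `1` has differences of smaller order. -/
theorem isLittleO_sub_of_continuousOn {x : ℕ → E} {C : ℝ} {ν : ℕ}
    (hx : ∀ m, ‖x m‖ ≤ C * ((m : ℝ) + 1) ^ ν) {G : ℂ → E}
    (hG : ∀ w : ℂ, ‖w‖ < 1 → HasSum (fun m => w ^ m • x m) (G w))
    (hGc : ContinuousOn G (Metric.closedBall 0 1 \ {1})) :
    (fun n : ℕ => x (n + 1) - x n) =o[atTop] fun n : ℕ => ((n : ℝ) + 1) ^ ν := by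
  have hC : 0 ≤ C := by simpa using (norm_nonneg _).trans (hx 0)
  obtain ⟨φ, hφ1, hφ2⟩ := exists_schwartz_bump
  obtain ⟨ψ, hψ⟩ : ∃ ψ : 𝓢(ℝ, ℂ), ψ = 𝓕 φ := ⟨_, rfl⟩
  rw [Asymptotics.isLittleO_iff]
  intro ε hε
  set D := C * ∫ t, ‖deriv ψ t‖ with hD
  have hD0 : 0 ≤ D := mul_nonneg hC (integral_nonneg fun _ => norm_nonneg _)
  -- The bound `1/8` keeps the bump inside a period; `D + 1` replaces `D`, which may be zero.
  set δ := min (1 / 8) (ε / (2 * (D + 1))) with hδ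
  have hδ0 : 0 < δ := by positivity
  have hδ1 : δ ≤ 1 / 8 := min_le_left _ _
  have hδ2 : δ * D < ε / 2 := by
    have h1 : δ * (D + 1) ≤ ε / 2 := by
      calc δ * (D + 1) ≤ ε / (2 * (D + 1)) * (D + 1) := by gcongr; exact min_le_right _ _
        _ = ε / 2 := by field_simp
    nlinarith
  set a : ℤ → ℂ := fun k => δ * ψ (δ * k) with ha
  -- The Fourier coefficients of `1 - φ(θ/δ)`; convolving with `c` removes the frequencies near `θ =
  -- 0`.
  set c : ℤ → ℂ := fun k => (if k = 0 then 1 else 0) - a k with hcdef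
  have has : Summable fun j : ℤ => ‖a j‖ * (1 + |(j : ℝ)|) ^ ν :=
    summable_schwartz_samples ψ hδ0 (by linarith) ν
  have hes : Summable fun j : ℤ => ‖(if j = 0 then 1 else 0 : ℂ)‖ * (1 + |(j : ℝ)|) ^ ν :=
    summable_of_ne_finset_zero (s := {0}) (by simp_all)
  have hsub : ∀ (f g : ℤ → ℂ), (Summable fun j : ℤ => ‖f j‖ * (1 + |(j : ℝ)|) ^ ν) →
      (Summable fun j : ℤ => ‖g j‖ * (1 + |(j : ℝ)|) ^ ν) →
      Summable fun j : ℤ => ‖f j - g j‖ * (1 + |(j : ℝ)|) ^ ν := fun f g hf hg => by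
    refine Summable.of_nonneg_of_le (fun j => by positivity) (fun j => ?_) (hf.add hg)
    rw [← add_mul]
    gcongr
    exact norm_sub_le _ _
  have hcs : Summable fun j : ℤ => ‖c j‖ * (1 + |(j : ℝ)|) ^ ν := hsub _ _ hes has
  have hshift : Summable fun j : ℤ => ‖a (j + 1)‖ * (1 + |(j : ℝ)|) ^ ν := by
    have h1 := (has.comp_injective (add_left_injective (1 : ℤ))).mul_left (2 ^ ν)
    refine Summable.of_nonneg_of_le (fun j => by positivity) (fun j => ?_) h1
    have h2 : 1 + |(j : ℝ)| ≤ 2 * (1 + |((j + 1 : ℤ) : ℝ)|) := by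
      have h3 := abs_sub_abs_le_abs_sub (j : ℝ) (-1)
      have h4 : |(j : ℝ) - (-1)| = |((j + 1 : ℤ) : ℝ)| := by push_cast; ring_nf
      rw [h4, abs_neg, abs_one] at h3
      linarith [abs_nonneg ((j + 1 : ℤ) : ℝ)]
    calc ‖a (j + 1)‖ * (1 + |(j : ℝ)|) ^ ν
        ≤ ‖a (j + 1)‖ * (2 * (1 + |((j + 1 : ℤ) : ℝ)|)) ^ ν := by gcongr
      _ = _ := by simp only [Function.comp]; rw [mul_pow]; ring
  have hds := hsub _ _ hshift has
  have hu : Tendsto (fun n : ℕ => ∑' m : ℕ, c (n - m) • x m) atTop (𝓝 0) := by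
    have hh : Continuous fun θ : ℝ => 1 - φ (θ / δ) :=
      continuous_const.sub (φ.continuous.comp (by fun_prop))
    have hh0 : ∀ θ : ℝ, |θ| < δ → 1 - φ (θ / δ) = 0 := fun θ hθ => by
      rw [hφ1, sub_self]
      rw [abs_div, abs_of_pos hδ0, div_le_one hδ0]
      exact hθ.le
    refine (tendsto_integral_fourierChar_nat
      fun θ => (1 - φ (θ / δ)) • G (𝐞 θ : ℂ)).congr fun n => ?_
    rw [tsum_convolution_eq_integral hx hG hGc hh hδ0 hh0
      (fun k => (integral_one_sub_bump_mul_fourierChar hφ2 hδ0 hδ1 k).trans (by rw [← hψ])) hcs]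
    simp only [smul_smul, mul_comm]
  have hsplit : ∀ n : ℕ, ∑' m : ℕ, c (n - m) • x m = x n - ∑' m : ℕ, a (n - m) • x m :=
    fun n => by
      have h1 : HasSum (fun m : ℕ => (if (n : ℤ) - m = 0 then 1 else 0 : ℂ) • x m) (x n) := by
        have := hasSum_single (f := fun m : ℕ => (if (n : ℤ) - m = 0 then 1 else 0 : ℂ) • x m) n
          (fun m hm => by rw [if_neg (by omega), zero_smul])
        simpa using this
      rw [← (h1.sub (summable_norm_convolution hx has n).of_norm.hasSum).tsum_eq]
      exact tsum_congr fun m => sub_smul _ _ _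
  -- The part away from frequency `0` tends to `0` itself; in the low-frequency part the difference
  -- is moved onto `a`.
  have hdiff : ∀ n : ℕ, x (n + 1) - x n =
      (∑' m : ℕ, c ((n + 1 : ℕ) - m) • x m - ∑' m : ℕ, c (n - m) • x m) +
        ∑' m : ℕ, (a (n - m + 1) - a (n - m)) • x m := fun n => by
    have h1 := (summable_norm_convolution hx has (n + 1)).of_norm
    have h2 := (summable_norm_convolution hx has n).of_norm
    have h3 : ∑' m : ℕ, (a (n - m + 1) - a (n - m)) • x m =
        ∑' m : ℕ, a ((n + 1 : ℕ) - m) • x m - ∑' m : ℕ, a (n - m) • x m := by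
      rw [← h1.tsum_sub h2]
      refine tsum_congr fun m => ?_
      rw [sub_smul]
      congr 3
      push_cast; ring
    rw [hsplit, hsplit, h3]; abel
  have hlt : C * ∑' j, ‖a (j + 1) - a j‖ < ε / 2 := by
    have h1 := tsum_norm_sub_schwartz_samples_le ψ hδ0
    calc C * ∑' j, ‖a (j + 1) - a j‖ ≤ C * (δ * ∫ t, ‖deriv ψ t‖) := by gcongr
      _ = δ * D := by rw [hD]; ring
      _ < _ := hδ2
  have hev1 := eventually_norm_convolution_le hC hx hds hlt
  have hu2 := ((tendsto_add_atTop_iff_nat 1).2 hu).sub hu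
  rw [sub_zero] at hu2
  have hev2 := (hu2.norm.eventually (gt_mem_nhds
    (show ‖(0 : E)‖ < ε / 2 by rw [norm_zero]; exact half_pos hε)))
  filter_upwards [hev1, hev2] with n h1 h2
  have hpow : 1 ≤ ((n : ℝ) + 1) ^ ν := one_le_pow₀ (by simp)
  rw [Real.norm_of_nonneg (by positivity), hdiff]
  refine (norm_add_le _ _).trans ?_
  have h3 : ε / 2 ≤ ε / 2 * ((n : ℝ) + 1) ^ ν := le_mul_of_one_le_right (by positivity) hpow
  linarith

end FracKT

/-! ### Iterated differences and the conclusion. -/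

namespace FracKT

theorem sub_one_pow_eq_sum {A : Type*} [Ring A] [Algebra ℂ A] (a : A) (N : ℕ) :
    (a - 1) ^ N = ∑ k ∈ Finset.range (N + 1), ((N.choose k : ℂ) * (-1) ^ (N + k)) • a ^ k := by
  have hcomm : Commute a (-1) := (Commute.one_right _).neg_right
  rw [sub_eq_add_neg, hcomm.add_pow]
  refine Finset.sum_congr rfl fun k hk => ?_
  obtain ⟨m, rfl⟩ := Nat.exists_eq_add_of_le (Nat.lt_succ_iff.1 (Finset.mem_range.1 hk))
  -- With `N = k + m`, the signs `(-1)^(N+k)` and `(-1)^(N-k)` agree.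
  have h : (-1 : ℂ) ^ (k + m + k) = (-1) ^ m := by
    rw [show k + m + k = m + 2 * k by ring, pow_add, pow_mul]
    simp
  rw [Nat.add_sub_cancel_left, h, Algebra.smul_def]
  simp only [map_mul, map_pow, map_neg, map_one, map_natCast]
  rw [mul_assoc (Nat.cast _), (Nat.cast_commute _ _).eq,
    ((Commute.one_right (a ^ k)).neg_right.pow_right m).eq]

section

variable {X : Type*} [NormedAddCommGroup X] [NormedSpace ℂ X]

theorem exists_growth_bound {x : ℕ → X →L[ℂ] X} {ν : ℕ}
    (hbdd : BddAbove ((fun n : ℕ => ‖x n‖ / (n : ℝ) ^ ν) '' Set.Ici 1)) :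
    ∃ C : ℝ, ∀ n, ‖x n‖ ≤ C * ((n : ℝ) + 1) ^ ν := by
  obtain ⟨B, hB⟩ := hbdd
  -- The term `‖x 0‖` and the shifted weight `n + 1` cover `n = 0`, about which the hypothesis says
  -- nothing.
  refine ⟨|B| + ‖x 0‖, fun n => ?_⟩
  have hpow : 1 ≤ ((n : ℝ) + 1) ^ ν := one_le_pow₀ (by simp)
  rcases Nat.eq_zero_or_pos n with rfl | hn
  · simp
  · have h1 : ‖x n‖ / (n : ℝ) ^ ν ≤ B := hB ⟨n, hn, rfl⟩
    have hn' : (0 : ℝ) < n := by exact_mod_cast hn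
    rw [div_le_iff₀ (by positivity)] at h1
    calc ‖x n‖ ≤ B * (n : ℝ) ^ ν := h1
      _ ≤ (|B| + ‖x 0‖) * ((n : ℝ) + 1) ^ ν := by
        gcongr
        · linarith [le_abs_self B, norm_nonneg (x 0)]
        · linarith

theorem shift_pow_apply (k : ℕ) (x : ℕ → X →L[ℂ] X) (n : ℕ) :
    (shift X ^ k) x n = x (n + k) := by
  induction k generalizing n with
  | zero => rfl
  | succ k ih =>
    rw [pow_succ', Module.End.mul_apply]
    exact (ih (n + 1)).trans (by rw [Nat.add_right_comm, Nat.add_assoc])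

theorem shift_sub_one_pow_apply (N : ℕ) (x : ℕ → X →L[ℂ] X) (n : ℕ) :
    ((shift X - 1) ^ N) x n =
      ∑ k ∈ Finset.range (N + 1), ((N.choose k : ℂ) * (-1) ^ (N + k)) • x (n + k) := by
  refine (congrFun (LinearMap.congr_fun (sub_one_pow_eq_sum
    (A := Module.End ℂ (ℕ → X →L[ℂ] X)) (shift X) N) x) n).trans ?_
  rw [LinearMap.sum_apply, Finset.sum_apply]
  refine Finset.sum_congr rfl fun k _ => ?_
  rw [LinearMap.smul_apply, Pi.smul_apply, shift_pow_apply]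

/-- Translation preserves `o(n^ν)` because `n + 2 ≤ 2(n + 1)`, hence so does every further
difference. -/
theorem isLittleO_shift_sub_one_pow {x : ℕ → X →L[ℂ] X} {ν : ℕ}
    (hx : x =o[atTop] fun n : ℕ => ((n : ℝ) + 1) ^ ν) (N : ℕ) :
    (((shift X - 1) ^ N) x) =o[atTop] fun n : ℕ => ((n : ℝ) + 1) ^ ν := by
  have hshift : (fun n : ℕ => (((n + 1 : ℕ) : ℝ) + 1) ^ ν) =O[atTop]
      fun n : ℕ => ((n : ℝ) + 1) ^ ν := by
    refine Asymptotics.IsBigO.pow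
      (Asymptotics.IsBigO.of_bound 2 (Eventually.of_forall fun n => ?_)) ν
    rw [Real.norm_of_nonneg (by positivity), Real.norm_of_nonneg (by positivity)]
    push_cast
    linarith [Nat.cast_nonneg (α := ℝ) n]
  induction N with
  | zero => exact hx
  | succ N ih =>
    rw [pow_succ', Module.End.mul_apply]
    exact ((ih.comp_tendsto (tendsto_add_atTop_nat 1)).trans_isBigO hshift).sub ih

theorem tendsto_one_div_pow_smul {x : ℕ → X →L[ℂ] X} {ν : ℕ}
    (hx : x =o[atTop] fun n : ℕ => ((n : ℝ) + 1) ^ ν) :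
    Tendsto (fun n : ℕ => (1 / (n : ℂ) ^ ν) • x n) atTop (𝓝 0) := by
  have h1 : (fun n : ℕ => ((n : ℝ) + 1) ^ ν) =O[atTop] fun n : ℕ => (n : ℝ) ^ ν := by
    refine Asymptotics.IsBigO.pow (Asymptotics.IsBigO.of_bound 2 ?_) ν
    filter_upwards [eventually_ge_atTop 1] with n hn
    have : (1 : ℝ) ≤ n := by exact_mod_cast hn
    rw [Real.norm_of_nonneg (by positivity), Real.norm_of_nonneg (by positivity)]
    linarith
  have h2 := (hx.trans_isBigO h1).norm_left.tendsto_div_nhds_zero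
  rw [tendsto_zero_iff_norm_tendsto_zero]
  refine h2.congr fun n => ?_
  rw [norm_smul, norm_div, norm_one, norm_pow, Complex.norm_natCast, one_div, inv_mul_eq_div]

end

end FracKT

theorem mainTheorem1 {X : Type*} [NormedAddCommGroup X] [NormedSpace ℂ X] [CompleteSpace X]
    (α : ℝ) (hα0 : 0 < α) (hα1 : α ≤ 1) (ν : ℕ) (T : X →L[ℂ] X)
    (hSigma : FracKT.singularSet α T ⊆ {1})
    (hbdd : BddAbove
      ((fun n : ℕ => ‖FracKT.alphaResolvent α T n‖ / (n : ℝ) ^ ν) '' Set.Ici 1)) :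
    Tendsto (fun n : ℕ => (1 / (n : ℂ) ^ ν) •
        (((FracKT.shift X - 1) ^ (ν + 1)) (FracKT.alphaResolvent α T)) n) atTop (𝓝 0) ∧
    Tendsto (fun n : ℕ => (1 / (n : ℂ) ^ ν) •
        ∑ k ∈ Finset.range (ν + 2), (((ν + 1).choose k : ℂ) * (-1) ^ (ν + 1 + k)) •
          FracKT.alphaResolvent α T (n + k)) atTop (𝓝 0) := by
  obtain ⟨C, hC⟩ := FracKT.exists_growth_bound hbdd
  have hs : ∀ w : ℂ, ‖w‖ < 1 → Summable fun n => ‖w ^ n • FracKT.alphaResolvent α T n‖ :=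
    fun w hw => FracKT.summable_norm_pow_smul hC hw
  have hdiff : (FracKT.shift X - 1) (FracKT.alphaResolvent α T) =o[atTop]
      fun n : ℕ => ((n : ℝ) + 1) ^ ν :=
    FracKT.isLittleO_sub_of_continuousOn hC
      (fun w hw => FracKT.hasSum_inverse_genInv hα0 T hw (hs w hw))
      (FracKT.continuousOn_inverse_genInv hα0 hSigma hs)
  have h : Tendsto (fun n : ℕ => (1 / (n : ℂ) ^ ν) •
      (((FracKT.shift X - 1) ^ (ν + 1)) (FracKT.alphaResolvent α T)) n) atTop (𝓝 0) := by
    -- One difference is applied first, where the Tauberian gain occurs; the other `ν` act on its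
    -- result.
    rw [pow_succ, Module.End.mul_apply]
    exact FracKT.tendsto_one_div_pow_smul (FracKT.isLittleO_shift_sub_one_pow hdiff ν)
  refine ⟨h, h.congr fun n => ?_⟩
  rw [FracKT.shift_sub_one_pow_apply]
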